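/- Suppose that there exist infinitely many cyclic cubic fields $k$ (Galois extensions of $\mathbb{Q}$ of degree $3$, taken inside $\mathbb{C}$) having a totally positive system of fundamental units, that is, a system of fundamental units $\epsilon_1,\epsilon_2$ that are positive under every real embedding of $k$. For an integer $m>2$ with $m$ odd or divisible by $4$, let $\mathbb{Q}(\zeta_m)^+=\mathbb{Q}(\zeta_m+\zeta_m^{-1})$ be the maximal totally real subfield of the $m$-th cyclotomic field. The unit signature rank of a totally real number field $F$ is the dimension over $\mathbb{F}_2$ of the group of signatures $(\operatorname{sgn} v(\epsilon))_{v}\in\prod_{v}\mathbb{F}_2$, where $\epsilon$ runs over the units of the ring of integers of $F$, $v$ runs over the real embeddings of $F$, and $\operatorname{sgn}(x)=0$ if $x>0$ and $\operatorname{sgn}(x)=1$ if $x<0$. Then the difference between $\varphi(m)/2$ and the unit signature rank of $\mathbb{Q}(\zeta_m)^+$ can be arbitrarily large: for every $N$ there is an integer $m>2$, odd or divisible by $4$, such that $\varphi(m)/2$ minus the unit signature rank of $\mathbb{Q}(\zeta_m)^+$ is at least $N$. -/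

import Mathlib

open NumberField

namespace SignatureRank

/-- The sign of a nonzero real number as an element of the additive group `𝔽₂`:
`0` for a positive number and `1` for a negative one. -/
noncomputable def sgn (x : ℝ) : ZMod 2 := if x < 0 then 1 else 0

theorem sgn_one : sgn 1 = 0 := by
  simp [sgn]

theorem sgn_mul {x y : ℝ} (hx : x ≠ 0) (hy : y ≠ 0) : sgn (x * y) = sgn x + sgn y := by
  have h2 : (1 : ZMod 2) + 1 = 0 := by decide
  rcases lt_or_gt_of_ne hx with h | h <;> rcases lt_or_gt_of_ne hy with h' | h'
  · simp [sgn, h, h', h2, not_lt_of_gt (mul_pos_of_neg_of_neg h h')]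
  · simp [sgn, h, not_lt_of_gt h', mul_neg_of_neg_of_pos h h']
  · simp [sgn, not_lt_of_gt h, h', mul_neg_of_pos_of_neg h h']
  · simp [sgn, not_lt_of_gt h, not_lt_of_gt h', not_lt_of_gt (mul_pos h h')]

/-- The archimedean signature map `α ↦ (sgn (v α))_v`, where `v` runs over the real embeddings
of `F`, from the multiplicative group of `F` to the additive group `∏_v 𝔽₂`. -/
noncomputable def signature (F : Type*) [Field F] :
    Additive Fˣ →+ ((F →+* ℝ) → ZMod 2) where
  toFun α := fun v => sgn (v ((Additive.toMul α : Fˣ) : F))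
  map_zero' := by
    funext v
    simp [sgn_one]
  map_add' α β := by
    funext v
    have h (u : Fˣ) : v (u : F) ≠ 0 := (map_ne_zero v).mpr u.ne_zero
    simp [sgn_mul (h _) (h _)]

/-- The signature map on the units of (the ring of integers of) `F`. -/
noncomputable def unitSignature (F : Type*) [Field F] :
    Additive (𝓞 F)ˣ →+ ((F →+* ℝ) → ZMod 2) :=
  (signature F).comp (MonoidHom.toAdditive (Units.map (algebraMap (𝓞 F) F : 𝓞 F →* F)))

/-- The unit signature group of `F`, an `𝔽₂`-subspace of the signature space. -/
noncomputable def unitSignatureGroup (F : Type*) [Field F] :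
    Submodule (ZMod 2) ((F →+* ℝ) → ZMod 2) :=
  AddSubgroup.toZModSubmodule 2 (unitSignature F).range

/-- The unit signature rank of `F`. -/
noncomputable def unitSignatureRank (F : Type*) [Field F] : ℕ :=
  Module.finrank (ZMod 2) (unitSignatureGroup F)

/-- `η` is a system of fundamental units of `K`: every unit of `K` is, in a unique way, a root of
unity times a product of integral powers of the `η i`. -/
def IsFundamentalSystem (K : Type*) [Field K] [NumberField K]
    (η : Fin (Units.rank K) → (𝓞 K)ˣ) : Prop :=
  ∀ u : (𝓞 K)ˣ, ∃! ζe : Units.torsion K × (Fin (Units.rank K) → ℤ),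
    u = (ζe.1 : (𝓞 K)ˣ) * ∏ i, η i ^ ζe.2 i

/-- An element of `K` is totally positive if it is positive under every real embedding. -/
def IsTotallyPositive {K : Type*} [Field K] (x : K) : Prop :=
  ∀ v : K →+* ℝ, 0 < v x

/-- `K` has a system of fundamental units all of which are totally positive. -/
def HasTotallyPositiveFundamentalUnits (K : Type*) [Field K] [NumberField K] : Prop :=
  ∃ η : Fin (Units.rank K) → (𝓞 K)ˣ,
    IsFundamentalSystem K η ∧ ∀ i, IsTotallyPositive (((η i : (𝓞 K)ˣ) : 𝓞 K) : K)

/-- A cyclic cubic field: a Galois extension of `ℚ` of degree 3 with cyclic Galois group. -/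
def IsCyclicCubic (K : Type*) [Field K] [NumberField K] : Prop :=
  Module.finrank ℚ K = 3 ∧ IsGalois ℚ K ∧ IsCyclic (K ≃ₐ[ℚ] K)

/-- The set of cyclic cubic fields, as subfields of `ℂ`, that have a totally positive system of
fundamental units. -/
def totallyPositiveCyclicCubicFields : Set (IntermediateField ℚ ℂ) :=
  {k | ∃ _ : NumberField k, IsCyclicCubic k ∧ HasTotallyPositiveFundamentalUnits k}

end SignatureRank

namespace SignatureRank

/-! ### Numbers whose quotient by their conjugate is a cube of a cyclotomic number -/

open ComplexConjugate

/-! Each cubic field in the hypothesis lies in a cyclotomic field, so N of them embed in one L =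
ℚ(ζ_n). Each supplies a totally positive unit that is not a square in its field. These N units lie
in L⁺ and in the kernel of its signature map. If they are independent modulo squares, rank-nullity
on units modulo squares, of dimension at most [L⁺ : ℚ] = φ(n)/2, gives deficiency at least N.

Independence (`exists_sq_of_mul_prod_eq_sq`): these units have norm 1. Given a product that is a
square, an automorphism σ fixing one cubic field and moving another makes 1 + σ + σ² kill the second
unit and cube the first. Repeating isolates one unit as a square in L, and
`HasTrivialNorm.exists_sq_of_eq_sq` pulls the root back to its cubic field, a contradiction.

The embedding (`le_cyclotomicClosure`) is Kronecker–Weber in degree 3, by Lagrange resolvents: the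
cube α of a resolvent lies in ℚ(ω) and has cube norm, so α has a cyclotomic cube root once α/ᾱ is a
cyclotomic cube. Factoring in ℤ[ω] reduces this to Jacobi sums of cubic characters
(`ConjQuotIsCube.eisenstein`). -/

/-- The field generated over `ℚ` by all complex roots of unity. -/
noncomputable def cyclotomicClosure : IntermediateField ℚ ℂ :=
  IntermediateField.adjoin ℚ {z | ∃ n : ℕ, 0 < n ∧ z ^ n = 1}

theorem mem_cyclotomicClosure_of_pow_eq_one {z : ℂ} {n : ℕ} (hn : 0 < n) (h : z ^ n = 1) :
    z ∈ cyclotomicClosure :=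
  IntermediateField.subset_adjoin _ _ ⟨n, hn, h⟩

/-- The quotient of `z` by its complex conjugate is a cube in `cyclotomicClosure`. -/
def ConjQuotIsCube (z : ℂ) : Prop := ∃ c ∈ cyclotomicClosure, c ^ 3 * conj z = z

theorem ConjQuotIsCube.mul {z w : ℂ} (hz : ConjQuotIsCube z) (hw : ConjQuotIsCube w) :
    ConjQuotIsCube (z * w) := by
  obtain ⟨c, hc, h⟩ := hz
  obtain ⟨d, hd, h'⟩ := hw
  refine ⟨c * d, mul_mem hc hd, ?_⟩
  rw [map_mul]
  linear_combination (d ^ 3 * conj w) * h + z * h'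

theorem ConjQuotIsCube.of_conj_eq {z : ℂ} (hz : conj z = z) : ConjQuotIsCube z :=
  ⟨1, one_mem _, by simp [hz]⟩

theorem ConjQuotIsCube.conj {z : ℂ} (hz : ConjQuotIsCube z) : ConjQuotIsCube (conj z) := by
  obtain ⟨c, hc, h⟩ := hz
  rcases eq_or_ne c 0 with rfl | hc0
  · have : z = 0 := by simpa using h.symm
    subst this
    exact ⟨0, zero_mem _, by simp⟩
  · refine ⟨c⁻¹, inv_mem hc, ?_⟩
    rw [Complex.conj_conj]
    nth_rewrite 1 [← h]
    field_simp

/-! ### Eisenstein integers and cubic Jacobi sums -/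

section Eisenstein

variable {ω : ℂ}

theorem omega_sq (hω : IsPrimitiveRoot ω 3) : ω ^ 2 = -1 - ω := by
  have h := hω.geom_sum_eq_zero (by norm_num)
  simp only [Finset.sum_range_succ, Finset.sum_range_zero] at h
  linear_combination h

theorem conj_omega (hω : IsPrimitiveRoot ω 3) : conj ω = -1 - ω := by
  have h1 : conj ω = ω⁻¹ :=
    (Complex.inv_eq_conj (hω.norm'_eq_one (by norm_num))).symm
  rw [h1]
  apply inv_eq_of_mul_eq_one_right
  linear_combination -omega_sq hω

/-- A unit z of ℤ[ω] is a sixth root of unity, so z/z̄ = z² is the cube of a ninth root of unity. -/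
theorem ConjQuotIsCube.of_norm_eq_one (hω : IsPrimitiveRoot ω 3) {x y : ℤ}
    (h : x ^ 2 - x * y + y ^ 2 = 1) : ConjQuotIsCube (x + y * ω) := by
  have hc : (x + y * ω : ℂ) * conj (x + y * ω : ℂ) = 1 := by
    have h' : (x ^ 2 - x * y + y ^ 2 : ℂ) = 1 := by exact_mod_cast h
    simp only [map_add, map_mul, map_intCast, conj_omega hω]
    linear_combination h' - y ^ 2 * omega_sq hω
  have h6 : (x + y * ω : ℂ) ^ 6 = 1 := by
    have h2 := omega_sq hω
    have h3 : ω ^ 3 = 1 := hω.pow_eq_one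
    -- From 4(x² - xy + y²) = (x - 2y)² + 3x².
    have hx : x ^ 2 ≤ 1 := by nlinarith [sq_nonneg (x - 2 * y), sq_nonneg x]
    have hy : y ^ 2 ≤ 1 := by nlinarith [sq_nonneg (y - 2 * x), sq_nonneg y]
    have hx1 := abs_le.mp ((sq_le_one_iff_abs_le_one x).mp hx)
    have hy1 := abs_le.mp ((sq_le_one_iff_abs_le_one y).mp hy)
    obtain ⟨hx1, hx2⟩ := hx1
    obtain ⟨hy1, hy2⟩ := hy1
    have hω6 : ω ^ 6 = 1 := by rw [show 6 = 3 * 2 by rfl, pow_mul, h3, one_pow]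
    have hs : (1 + ω) ^ 6 = 1 := by
      rw [show 1 + ω = -ω ^ 2 by rw [h2]; ring]
      rw [show (-ω ^ 2) ^ 6 = (ω ^ 6) ^ 2 by ring, hω6, one_pow]
    interval_cases x <;> interval_cases y <;> norm_num at h <;> push_cast
    · linear_combination hs
    · ring
    · linear_combination hω6
    · linear_combination hω6
    · ring
    · linear_combination hs
  set z := (x + y * ω : ℂ)
  have h0 : z ≠ 0 := left_ne_zero_of_mul_eq_one hc
  obtain ⟨w, hw⟩ := IsAlgClosed.exists_pow_nat_eq (z ^ 2) (n := 3) (by norm_num)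
  refine ⟨w, mem_cyclotomicClosure_of_pow_eq_one (n := 9) (by norm_num) ?_, ?_⟩
  · rw [show 9 = 3 * 3 by rfl, pow_mul, hw, ← pow_mul, h6]
  · rw [hw]; linear_combination z * hc

/-- With π = a + bω, the number ya - xb is the ω-coordinate of (x + yω)π̄. Since p divides the norm
of that product, it divides the other coordinate too; dividing by p = ππ̄ gives the cofactor of π.
-/
theorem exists_factor_of_dvd {p : ℤ} (hp : Prime p) {x y a b : ℤ}
    (hab : a ^ 2 - a * b + b ^ 2 = p) (hxy : p ∣ x ^ 2 - x * y + y ^ 2)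
    (hd : p ∣ y * a - x * b) :
    ∃ x' y' : ℤ, x = x' * a - y' * b ∧ y = x' * b + y' * a - y' * b ∧
      (x' ^ 2 - x' * y' + y' ^ 2) * p = x ^ 2 - x * y + y ^ 2 := by
  obtain ⟨d, hd⟩ := hd
  obtain ⟨n, hn⟩ := hxy
  have hc : p ∣ x * a + y * b - x * b := by
    apply hp.dvd_of_dvd_pow (n := 2)
    refine ⟨n * p + (x * a + y * b - x * b) * d - p * d ^ 2, ?_⟩
    linear_combination (a ^ 2 - a * b + b ^ 2) * hn + p * n * hab +
      (x * a + y * b - x * b - (y * a - x * b) - p * d) * hd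
  obtain ⟨c, hc⟩ := hc
  have hp0 := hp.ne_zero
  refine ⟨c, d, ?_, ?_, ?_⟩
  · apply mul_left_cancel₀ hp0
    linear_combination a * hc - b * hd - x * hab
  · apply mul_left_cancel₀ hp0
    linear_combination b * hc + (a - b) * hd - y * hab
  · apply mul_left_cancel₀ hp0
    have hcd : (p * c) ^ 2 - (p * c) * (p * d) + (p * d) ^ 2
        = (x ^ 2 - x * y + y ^ 2) * (a ^ 2 - a * b + b ^ 2) := by
      rw [← hc, ← hd]; ring
    rw [hab] at hcd
    linear_combination hcd

/-- Modulo p, -x/y is a root of t² + t + 1, hence has order 3 in the unit group unless p = 3. -/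
theorem prime_mod_three {p : ℕ} [Fact p.Prime] {x y : ℤ} (h : (p : ℤ) ∣ x ^ 2 - x * y + y ^ 2)
    (hxy : ¬ ((p : ℤ) ∣ x ∧ (p : ℤ) ∣ y)) : p = 3 ∨ 3 ∣ p - 1 := by
  by_cases h3 : p = 3
  · exact Or.inl h3
  right
  have hy : (y : ZMod p) ≠ 0 := by
    intro hy
    rw [ZMod.intCast_zmod_eq_zero_iff_dvd] at hy
    refine hxy ⟨?_, hy⟩
    apply (Nat.prime_iff_prime_int.mp (Fact.out : p.Prime)).dvd_of_dvd_pow (n := 2)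
    have : x ^ 2 = (x ^ 2 - x * y + y ^ 2) + y * (x - y) := by ring
    rw [this]
    exact dvd_add h (hy.mul_right _)
  have h' : (x : ZMod p) ^ 2 - x * y + y ^ 2 = 0 := by
    have := (ZMod.intCast_zmod_eq_zero_iff_dvd _ p).mpr h
    push_cast at this
    exact this
  set t : ZMod p := -(x / y) with ht
  have ht2 : t ^ 2 + t + 1 = 0 := by
    rw [ht]; field_simp
    linear_combination h'
  have ht3 : t ^ 3 = 1 := by linear_combination (t - 1) * ht2
  have ht1 : t ≠ 1 := by
    intro h1
    rw [h1] at ht2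
    have : ((3 : ℕ) : ZMod p) = 0 := by push_cast; linear_combination ht2
    rw [ZMod.natCast_eq_zero_iff] at this
    exact h3 ((Nat.prime_dvd_prime_iff_eq Fact.out Nat.prime_three).mp this)
  have ht0 : t ≠ 0 := by rintro h0; rw [h0] at ht3; norm_num at ht3
  have : orderOf t = 3 := orderOf_eq_prime ht3 ht1
  rw [← this]
  exact orderOf_dvd_of_pow_eq_one (ZMod.pow_card_sub_one_eq_one ht0)

theorem exists_int_of_mem_adjoin (hω : IsPrimitiveRoot ω 3) {z : ℂ}
    (hz : z ∈ Algebra.adjoin ℤ {ω}) : ∃ a b : ℤ, z = a + b * ω := by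
  induction hz using Algebra.adjoin_induction with
  | mem x hx => exact ⟨0, 1, by simp_all⟩
  | algebraMap r => exact ⟨r, 0, by simp⟩
  | add x y _ _ hx hy =>
    obtain ⟨a, b, rfl⟩ := hx
    obtain ⟨c, d, rfl⟩ := hy
    exact ⟨a + c, b + d, by push_cast; ring⟩
  | mul x y _ _ hx hy =>
    obtain ⟨a, b, rfl⟩ := hx
    obtain ⟨c, d, rfl⟩ := hy
    exact ⟨a * c - b * d, a * d + b * c - b * d, by
      push_cast; linear_combination b * d * omega_sq hω⟩

theorem gaussSum_mem_cyclotomicClosure {F : Type*} [Field F] [Fintype F] (χ : MulChar F ℂ)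
    (ψ : AddChar F ℂ) : gaussSum χ ψ ∈ cyclotomicClosure := by
  refine sum_mem fun a _ ↦ mul_mem ?_ ?_
  · by_cases ha : a = 0
    · subst ha; rw [MulChar.map_zero]; exact zero_mem _
    · apply mem_cyclotomicClosure_of_pow_eq_one (n := Fintype.card F - 1)
      · have := Fintype.one_lt_card (α := F); omega
      · rw [← map_pow, FiniteField.pow_card_sub_one_eq_one a ha, map_one]
  · apply mem_cyclotomicClosure_of_pow_eq_one (n := Fintype.card F) Fintype.card_pos
    rw [← AddChar.map_nsmul_eq_pow, card_nsmul_eq_zero, AddChar.map_zero_eq_one]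

/-- For p = 3 take 1 + 2ω, whose conjugate is its negative. Otherwise take the Jacobi sum J of a
cubic character: JJ̄ = p, and the Gauss sum satisfies g³ = pJ, so J/J̄ = J²/p = (J/g)³. -/
theorem exists_norm_eq_prime (hω : IsPrimitiveRoot ω 3) {p : ℕ} [hp : Fact p.Prime]
    (h : p = 3 ∨ 3 ∣ p - 1) :
    ∃ a b : ℤ, a ^ 2 - a * b + b ^ 2 = p ∧ ConjQuotIsCube (a + b * ω) := by
  rcases h with rfl | h3
  · refine ⟨1, 2, by norm_num, -1, neg_mem (one_mem _), ?_⟩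
    simp only [map_add, map_mul, map_intCast, conj_omega hω]
    simp only [Int.cast_one, Int.cast_ofNat]
    ring
  · obtain ⟨χ, hχ⟩ := MulChar.exists_mulChar_orderOf (ZMod p) (by rwa [ZMod.card]) hω
    obtain ⟨a, b, hJ⟩ := exists_int_of_mem_adjoin hω
      (jacobiSum_mem_algebraAdjoin_of_pow_eq_one (hχ ▸ pow_orderOf_eq_one χ : χ ^ 3 = 1)
        (hχ ▸ pow_orderOf_eq_one χ : χ ^ 3 = 1) hω)
    have hχ3 : χ ^ 3 = 1 := hχ ▸ pow_orderOf_eq_one χ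
    have hχ1 : χ ≠ 1 := by rintro rfl; simp at hχ
    have hχ2 : χ * χ ≠ 1 := by
      intro h2
      apply hχ1
      rw [← hχ3, pow_succ, pow_two, h2, one_mul]
    have hconj : conj (jacobiSum χ χ) = jacobiSum χ⁻¹ χ⁻¹ := by
      rw [← jacobiSum_ringHomComp]
      congr 1 <;> exact MulChar.star_eq_inv χ
    have hnorm : jacobiSum χ χ * conj (jacobiSum χ χ) = p := by
      rw [hconj, jacobiSum_mul_jacobiSum_inv _ hχ1 hχ1 hχ2, ZMod.card]
      rw [ringChar.eq_zero, ZMod.ringChar_zmod_n]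
      exact hp.out.ne_zero.symm
    have hJ0 : jacobiSum χ χ ≠ 0 := by
      intro h0
      rw [h0, zero_mul] at hnorm
      exact hp.out.ne_zero (by exact_mod_cast hnorm.symm)
    have hg := gaussSum_pow_eq_prod_jacobiSum (χ := χ) (by omega)
      (ZMod.isPrimitive_stdAddChar p)
    have hm1 : χ (-1) = 1 := by
      have : χ (-1) ^ 2 = 1 := by rw [← map_pow]; simp
      have h3 : χ (-1) ^ 3 = 1 := by
        rw [← MulChar.pow_apply' χ (by norm_num), hχ3, MulChar.one_apply isUnit_one.neg]
      rw [← h3, pow_succ, this, one_mul]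
    have hprod : ∏ i ∈ Finset.Ico 1 (orderOf χ - 1), jacobiSum χ (χ ^ i) = jacobiSum χ χ := by
      rw [hχ]; simp
    rw [hprod, hm1, ZMod.card, hχ, one_mul] at hg
    have hp0 : (p : ℂ) ≠ 0 := by exact_mod_cast hp.out.ne_zero
    refine ⟨a, b, ?_, ?_⟩
    · rw [hJ] at hnorm
      simp only [map_add, map_mul, map_intCast, conj_omega hω] at hnorm
      have : (a ^ 2 - a * b + b ^ 2 : ℂ) = p := by
        linear_combination hnorm + b ^ 2 * omega_sq hω
      exact_mod_cast this
    · rw [← hJ]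
      have hω' : ω ∈ cyclotomicClosure :=
        mem_cyclotomicClosure_of_pow_eq_one (n := 3) (by norm_num) hω.pow_eq_one
      have hJm : jacobiSum χ χ ∈ cyclotomicClosure := by
        rw [hJ]
        exact add_mem (intCast_mem _ _) (mul_mem (intCast_mem _ _) hω')
      refine ⟨jacobiSum χ χ / gaussSum χ ZMod.stdAddChar,
        div_mem hJm (gaussSum_mem_cyclotomicClosure _ _), ?_⟩
      rw [div_pow, hg]
      field_simp
      linear_combination hnorm

/-- Induction on the norm: split off a rational prime, or an element of prime norm or its conjugate.
-/
theorem ConjQuotIsCube.eisenstein (hω : IsPrimitiveRoot ω 3) (n : ℕ) :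
    ∀ x y : ℤ, x ^ 2 - x * y + y ^ 2 = n → ConjQuotIsCube (x + y * ω) := by
  induction n using Nat.strong_induction_on with
  | _ n ih =>
  intro x y hn
  rcases eq_or_ne n 0 with rfl | hn0
  · have hx : x = 0 := by
      have : x ^ 2 = 0 := by push_cast at hn; nlinarith [sq_nonneg (x - 2 * y), sq_nonneg x]
      simpa using this
    have hy : y = 0 := by subst hx; simpa using hn
    subst hx hy
    exact ConjQuotIsCube.of_conj_eq (by simp)
  rcases eq_or_ne n 1 with rfl | hn1
  · exact ConjQuotIsCube.of_norm_eq_one hω (by simpa using hn)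
  have hp : n.minFac.Prime := Nat.minFac_prime hn1
  have hdvd : ((n.minFac : ℕ) : ℤ) ∣ n := by exact_mod_cast n.minFac_dvd
  generalize n.minFac = p at hp hdvd
  have : Fact p.Prime := ⟨hp⟩
  have hpi : Prime (p : ℤ) := Nat.prime_iff_prime_int.mp hp
  have hp2 : (2 : ℤ) ≤ p := by exact_mod_cast hp.two_le
  have hnpos : (0 : ℤ) < n := by exact_mod_cast Nat.pos_of_ne_zero hn0
  have key : ∀ (x' y' k : ℤ), 2 ≤ k → (x' ^ 2 - x' * y' + y' ^ 2) * k = n →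
      ConjQuotIsCube (x' + y' * ω) := by
    intro x' y' k hk h
    have h0 : 0 ≤ x' ^ 2 - x' * y' + y' ^ 2 := by
      nlinarith [sq_nonneg (x' - y'), sq_nonneg (x' + y')]
    obtain ⟨n', hn'⟩ := Int.eq_ofNat_of_zero_le h0
    refine ih n' ?_ x' y' hn'
    rw [hn'] at h
    have : (n' : ℤ) < n := by nlinarith
    exact_mod_cast this
  by_cases hxy : (p : ℤ) ∣ x ∧ (p : ℤ) ∣ y
  · obtain ⟨⟨x', rfl⟩, ⟨y', rfl⟩⟩ := hxy
    have h1 := key x' y' (p ^ 2) (by nlinarith) (by rw [← hn]; ring)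
    have h2 : ConjQuotIsCube (p : ℂ) := ConjQuotIsCube.of_conj_eq (by simp)
    convert h2.mul h1 using 1
    push_cast; ring
  rw [← hn] at hdvd
  obtain ⟨a, b, hab, hJ⟩ := exists_norm_eq_prime hω (prime_mod_three hdvd hxy)
  -- The factors are the ω-coordinates of (x + yω)π̄ and (x + yω)π, where π = a + bω; they decide
  -- whether π or π̄ splits off.
  have hprod : (p : ℤ) ∣ (y * a - x * b) * (y * (a - b) - x * (-b)) := by
    have : (y * a - x * b) * (y * (a - b) - x * (-b)) =
        y ^ 2 * (a ^ 2 - a * b + b ^ 2) - b ^ 2 * (x ^ 2 - x * y + y ^ 2) := by ring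
    rw [this, hab]
    exact dvd_sub (dvd_mul_left _ _) (hdvd.mul_left _)
  rcases hpi.dvd_or_dvd hprod with hd | hd
  · obtain ⟨x', y', rfl, rfl, hN⟩ := exists_factor_of_dvd hpi hab hdvd hd
    convert (key x' y' p hp2 (by rw [hN, hn])).mul hJ using 1
    push_cast
    linear_combination -y' * b * omega_sq hω
  · have hab' : (a - b) ^ 2 - (a - b) * (-b) + (-b) ^ 2 = (p : ℤ) := by rw [← hab]; ring
    obtain ⟨x', y', rfl, rfl, hN⟩ := exists_factor_of_dvd hpi hab' hdvd hd
    convert (key x' y' p hp2 (by rw [hN, hn])).mul hJ.conj using 1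
    simp only [map_add, map_mul, map_intCast, conj_omega hω]
    push_cast
    linear_combination y' * b * omega_sq hω

/-- A cube root of an element of `ℚ(ω)` whose norm is a rational cube generates an abelian
extension. -/
theorem mem_cyclotomicClosure_of_cube (hω : IsPrimitiveRoot ω 3) {z : ℂ} {x y r : ℚ}
    (hz : z ^ 3 = x + y * ω) (hr : x ^ 2 - x * y + y ^ 2 = r ^ 3) : z ∈ cyclotomicClosure := by
  rcases eq_or_ne z 0 with rfl | hz0
  · exact zero_mem _
  have hω' : ω ∈ cyclotomicClosure :=
    mem_cyclotomicClosure_of_pow_eq_one (n := 3) (by norm_num) hω.pow_eq_one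
  have hq (q : ℚ) : (q : ℂ) ∈ cyclotomicClosure := by
    simp
  set α : ℂ := x + y * ω with hα
  have hαm : α ∈ cyclotomicClosure := add_mem (hq _) (mul_mem (hq _) hω')
  have hα0 : α ≠ 0 := hz ▸ pow_ne_zero 3 hz0
  have hcube : ConjQuotIsCube α := by
    have h1 : ConjQuotIsCube ((x.num * y.den : ℤ) + (y.num * x.den : ℤ) * ω) := by
      have h0 : 0 ≤ (x.num * y.den : ℤ) ^ 2 - (x.num * y.den : ℤ) * (y.num * x.den : ℤ) +
          (y.num * x.den : ℤ) ^ 2 := by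
        generalize (x.num * y.den : ℤ) = u
        generalize (y.num * x.den : ℤ) = v
        nlinarith [sq_nonneg (u - v), sq_nonneg (u + v)]
      obtain ⟨n, hn⟩ := Int.eq_ofNat_of_zero_le h0
      exact ConjQuotIsCube.eisenstein hω n _ _ hn
    have h2 : ConjQuotIsCube (((x.den * y.den : ℚ)⁻¹ : ℚ) : ℂ) :=
      ConjQuotIsCube.of_conj_eq (by simp)
    convert h2.mul h1 using 1
    have hx : (x : ℂ) = x.num / x.den := by exact_mod_cast (Rat.num_div_den x).symm
    have hy : (y : ℂ) = y.num / y.den := by exact_mod_cast (Rat.num_div_den y).symm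
    have hx0 : (x.den : ℂ) ≠ 0 := by exact_mod_cast x.den_nz
    have hy0 : (y.den : ℂ) ≠ 0 := by exact_mod_cast y.den_nz
    rw [hα]
    push_cast
    nth_rewrite 1 [hx, hy]
    field_simp
  obtain ⟨c, hc, hcα⟩ := hcube
  have hnorm : α * conj α = r ^ 3 := by
    have : (x ^ 2 - x * y + y ^ 2 : ℂ) = r ^ 3 := by exact_mod_cast hr
    have hc (q : ℚ) : conj (q : ℂ) = q := map_ratCast _ q
    simp only [hα, map_add, map_mul, hc, conj_omega hω]
    linear_combination this - y ^ 2 * omega_sq hω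
  -- Here c³ = α/ᾱ and r³ = αᾱ. Hence z differs from α/(cr) only by a cube root of unity.
  have hsq : (c * r) ^ 3 = α ^ 2 := by linear_combination α * hcα - c ^ 3 * hnorm
  have hcr : c * r ≠ 0 := by
    intro h0
    rw [h0] at hsq
    exact hα0 (by simpa using hsq.symm)
  have hu : (z * (c * r) / α) ^ 3 = 1 := by
    rw [div_pow, mul_pow, hz, hsq]; field_simp
  have : z = (z * (c * r) / α) * α / (c * r) := by
    rw [div_mul_cancel₀ _ hα0, mul_div_cancel_right₀ _ hcr]
  rw [this]
  exact div_mem (mul_mem (mem_cyclotomicClosure_of_pow_eq_one (by norm_num) hu) hαm)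
    (mul_mem hc (hq r))

end Eisenstein

open ComplexConjugate

/-! ### Galois action on a cubic field -/

section CubicGalois

variable {K : Type*} [Field K] [NumberField K] [IsGalois ℚ K]

theorem orderOf_eq_three (h : Module.finrank ℚ K = 3) {σ : K ≃ₐ[ℚ] K} (hσ : σ ≠ 1) :
    orderOf σ = 3 := by
  have hcard : Nat.card (K ≃ₐ[ℚ] K) = 3 := by rw [IsGalois.card_aut_eq_finrank, h]
  have : Fact (Nat.Prime 3) := ⟨Nat.prime_three⟩
  apply orderOf_eq_prime _ hσ
  rw [← hcard, pow_card_eq_one']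

theorem mem_zpowers_of_finrank_eq_three (h : Module.finrank ℚ K = 3) {σ : K ≃ₐ[ℚ] K} (hσ : σ ≠ 1)
    (τ : K ≃ₐ[ℚ] K) : τ ∈ Subgroup.zpowers σ := by
  have hcard : Nat.card (K ≃ₐ[ℚ] K) = 3 := by rw [IsGalois.card_aut_eq_finrank, h]
  have : Fact (Nat.Prime 3) := ⟨Nat.prime_three⟩
  exact mem_zpowers_of_prime_card hcard hσ

theorem apply_apply_apply_eq (h : Module.finrank ℚ K = 3) {σ : K ≃ₐ[ℚ] K} (hσ : σ ≠ 1) (x : K) :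
    σ (σ (σ x)) = x := by
  have := pow_orderOf_eq_one σ
  rw [orderOf_eq_three h hσ] at this
  exact DFunLike.congr_fun this x

theorem exists_rat_eq_of_fixed (h : Module.finrank ℚ K = 3) {σ : K ≃ₐ[ℚ] K} (hσ : σ ≠ 1) {x : K}
    (hx : σ x = x) : ∃ q : ℚ, (q : K) = x := by
  have : x ∈ (⊥ : IntermediateField ℚ K) := by
    rw [IsGalois.mem_bot_iff_fixed]
    intro τ
    obtain ⟨n, rfl⟩ := mem_zpowers_of_finrank_eq_three h hσ τ
    have : σ ∈ MulAction.stabilizer (K ≃ₐ[ℚ] K) x := hx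
    exact Subgroup.zpow_mem _ this n
  obtain ⟨q, hq⟩ := IntermediateField.mem_bot.mp this
  exact ⟨q, by simpa using hq⟩

theorem exists_ne_one (h : Module.finrank ℚ K = 3) : ∃ σ : K ≃ₐ[ℚ] K, σ ≠ 1 := by
  have hcard : Nat.card (K ≃ₐ[ℚ] K) = 3 := by rw [IsGalois.card_aut_eq_finrank, h]
  have : Nontrivial (K ≃ₐ[ℚ] K) := by
    rw [← Finite.one_lt_card_iff_nontrivial, hcard]; norm_num
  exact exists_ne 1

end CubicGalois

/-! ### Lagrange resolvents and cyclotomic levels -/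

/-- If the cyclic invariants of `a, b, c` are rational, the Lagrange resolvent of `a, b, c` lies in
`cyclotomicClosure`. -/
theorem resolvent_mem_cyclotomicClosure {ω : ℂ} (hω : IsPrimitiveRoot ω 3) {a b c : ℂ}
    {A B C R : ℚ} (hA : (A : ℂ) = a ^ 3 + b ^ 3 + c ^ 3 + 6 * a * b * c)
    (hB : (B : ℂ) = a ^ 2 * b + b ^ 2 * c + c ^ 2 * a)
    (hC : (C : ℂ) = a * b ^ 2 + b * c ^ 2 + c * a ^ 2)
    (hR : (R : ℂ) = a ^ 2 + b ^ 2 + c ^ 2 - a * b - b * c - c * a) :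
    a + ω * b + ω ^ 2 * c ∈ cyclotomicClosure := by
  have h3 : ω ^ 3 = 1 := hω.pow_eq_one
  -- The cube of the resolvent is A + 3Bω + 3Cω², rewritten with ω² = -1 - ω. R is the product of
  -- the resolvent with the one having ω and ω² exchanged.
  refine mem_cyclotomicClosure_of_cube hω (x := A - 3 * C) (y := 3 * B - 3 * C) (r := R) ?_ ?_
  · push_cast
    rw [hA, hB, hC]
    linear_combination (3 * b ^ 2 * a + 3 * c ^ 2 * b + 3 * a ^ 2 * c) * omega_sq hω +
      (b ^ 3 + 6 * a * b * c + c ^ 3 * (ω ^ 3 + 1) + 3 * c ^ 2 * a * ω + 3 * b ^ 2 * c * ω +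
        3 * b * c ^ 2 * ω ^ 2) * h3
  · have : ((A : ℂ) - 3 * C) ^ 2 - (A - 3 * C) * (3 * B - 3 * C) + (3 * B - 3 * C) ^ 2
        = R ^ 3 := by
      rw [hA, hB, hC, hR]; ring
    exact_mod_cast this

/-- Three times an element is its trace plus its two resolvents. The cyclic invariants of its
conjugates are fixed by σ, hence rational. -/
theorem le_cyclotomicClosure (k : IntermediateField ℚ ℂ) [NumberField k] [IsGalois ℚ k]
    (h : Module.finrank ℚ k = 3) : k ≤ cyclotomicClosure := by
  intro θ hθ
  obtain ⟨σ, hσ⟩ := exists_ne_one h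
  obtain ⟨a, ha⟩ : ∃ a : k, a = ⟨θ, hθ⟩ := ⟨_, rfl⟩
  obtain ⟨b, hb⟩ : ∃ b, σ a = b := ⟨_, rfl⟩
  obtain ⟨c, hc⟩ : ∃ c, σ b = c := ⟨_, rfl⟩
  have hca : σ c = a := by rw [← hc, ← hb, apply_apply_apply_eq h hσ]
  obtain ⟨ω, hω⟩ : ∃ ω : ℂ, IsPrimitiveRoot ω 3 := ⟨_, Complex.isPrimitiveRoot_exp 3 (by norm_num)⟩
  obtain ⟨T, hT⟩ := exists_rat_eq_of_fixed h hσ (x := a + b + c) (by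
    simp only [map_add, hb, hc, hca]; ring)
  obtain ⟨A, hA⟩ := exists_rat_eq_of_fixed h hσ (x := a ^ 3 + b ^ 3 + c ^ 3 + 6 * a * b * c) (by
    simp only [map_add, map_mul, map_pow, map_ofNat, hb, hc, hca]; ring)
  obtain ⟨B, hB⟩ := exists_rat_eq_of_fixed h hσ (x := a ^ 2 * b + b ^ 2 * c + c ^ 2 * a) (by
    simp only [map_add, map_mul, map_pow, hb, hc, hca]; ring)
  obtain ⟨C, hC⟩ := exists_rat_eq_of_fixed h hσ (x := a * b ^ 2 + b * c ^ 2 + c * a ^ 2) (by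
    simp only [map_add, map_mul, map_pow, hb, hc, hca]; ring)
  obtain ⟨R, hR⟩ := exists_rat_eq_of_fixed h hσ
    (x := a ^ 2 + b ^ 2 + c ^ 2 - a * b - b * c - c * a) (by
    simp only [map_add, map_sub, map_mul, map_pow, hb, hc, hca]; ring)
  replace hT := congrArg (algebraMap k ℂ) hT
  replace hA := congrArg (algebraMap k ℂ) hA
  replace hB := congrArg (algebraMap k ℂ) hB
  replace hC := congrArg (algebraMap k ℂ) hC
  replace hR := congrArg (algebraMap k ℂ) hR
  simp only [map_add, map_sub, map_mul, map_pow, map_ofNat, map_ratCast] at hT hA hB hC hR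
  have hθa : algebraMap k ℂ a = θ := by rw [ha]; rfl
  have h1 := resolvent_mem_cyclotomicClosure hω hA hB hC hR
  have h2 := resolvent_mem_cyclotomicClosure hω (a := algebraMap k ℂ a) (b := algebraMap k ℂ c)
    (c := algebraMap k ℂ b) (A := A) (B := C) (C := B) (R := R) (by rw [hA]; ring)
    (by rw [hC]; ring) (by rw [hB]; ring) (by rw [hR]; ring)
  rw [hθa] at h1 h2 hT
  have hTm : (T : ℂ) ∈ cyclotomicClosure := by simp
  have : θ = (T + (θ + ω * algebraMap k ℂ b + ω ^ 2 * algebraMap k ℂ c) +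
      (θ + ω * algebraMap k ℂ c + ω ^ 2 * algebraMap k ℂ b)) / 3 := by
    rw [hT, omega_sq hω]; ring
  rw [this]
  exact div_mem (add_mem (add_mem hTm h1) h2) (ofNat_mem _ 3)

theorem exists_level_of_mem {z : ℂ} (hz : z ∈ cyclotomicClosure) :
    ∃ m : ℕ, 0 < m ∧ z ∈ IntermediateField.adjoin ℚ {z : ℂ | z ^ m = 1} := by
  have mono {m n : ℕ} (h : m ∣ n) : IntermediateField.adjoin ℚ {z : ℂ | z ^ m = 1} ≤
      IntermediateField.adjoin ℚ {z : ℂ | z ^ n = 1} := by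
    apply IntermediateField.adjoin.mono
    rintro z (hz : z ^ m = 1)
    obtain ⟨d, rfl⟩ := h
    simp [pow_mul, hz]
  induction hz using IntermediateField.adjoin_induction with
  | mem x hx =>
    obtain ⟨n, hn, h⟩ := hx
    exact ⟨n, hn, IntermediateField.subset_adjoin _ _ h⟩
  | algebraMap x => exact ⟨1, one_pos, IntermediateField.algebraMap_mem _ x⟩
  | add x y _ _ hx hy =>
    obtain ⟨m, hm, hx⟩ := hx
    obtain ⟨n, hn, hy⟩ := hy
    exact ⟨m * n, mul_pos hm hn,
      add_mem (mono (Nat.dvd_mul_right _ _) hx) (mono (Nat.dvd_mul_left _ _) hy)⟩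
  | inv x _ hx =>
    obtain ⟨m, hm, hx⟩ := hx
    exact ⟨m, hm, inv_mem hx⟩
  | mul x y _ _ hx hy =>
    obtain ⟨m, hm, hx⟩ := hx
    obtain ⟨n, hn, hy⟩ := hy
    exact ⟨m * n, mul_pos hm hn,
      mul_mem (mono (Nat.dvd_mul_right _ _) hx) (mono (Nat.dvd_mul_left _ _) hy)⟩

/-- A finite extension of `ℚ` inside `cyclotomicClosure` is contained in a cyclotomic field. -/
theorem exists_level {k : IntermediateField ℚ ℂ} [NumberField k]
    (h : k ≤ cyclotomicClosure) :
    ∃ m : ℕ, 0 < m ∧ k ≤ IntermediateField.adjoin ℚ {z : ℂ | z ^ m = 1} := by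
  obtain ⟨α, hα⟩ := Field.exists_primitive_element ℚ k
  obtain ⟨m, hm, hαm⟩ := exists_level_of_mem (h α.2)
  refine ⟨m, hm, fun x hx ↦ ?_⟩
  have hle : IntermediateField.adjoin ℚ {α} ≤
      (IntermediateField.adjoin ℚ {z : ℂ | z ^ m = 1}).comap (algebraMap k ℂ).toRatAlgHom := by
    rw [IntermediateField.adjoin_simple_le_iff]
    exact hαm
  rw [hα] at hle
  exact hle (IntermediateField.mem_top (x := (⟨x, hx⟩ : k)))

theorem adjoin_roots_le_fieldRange {m n : ℕ} [NeZero n] (hmn : m ∣ n) {L : Type*} [Field L]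
    [CharZero L] [IsCyclotomicExtension {n} ℚ L] (φ : L →ₐ[ℚ] ℂ) :
    IntermediateField.adjoin ℚ {z : ℂ | z ^ m = 1} ≤ φ.fieldRange := by
  rw [IntermediateField.adjoin_le_iff]
  rintro z (hz : z ^ m = 1)
  have hprim := (IsCyclotomicExtension.zeta_spec n ℚ L).map_of_injective (f := φ) φ.injective
  obtain ⟨d, rfl⟩ := hmn
  obtain ⟨i, -, rfl⟩ := hprim.eq_pow_of_pow_eq_one (ξ := z) (by rw [pow_mul, hz, one_pow])
  exact pow_mem (AlgHom.mem_fieldRange.mpr ⟨_, rfl⟩) i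

/-! ### Squares and independence in abelian extensions -/

section Squares

variable {F L : Type*} [Field F] [Field L] [Algebra F L]

/-- `x` is a nonzero element of `K` such that `x * σ x * σ (σ x) = 1` for all automorphisms `σ`
acting nontrivially on `K`. -/
structure HasTrivialNorm (K : IntermediateField F L) (x : L) : Prop where
  mem : x ∈ K
  ne_zero : x ≠ 0
  mul_mul_eq_one : ∀ σ : L ≃ₐ[F] L, (∃ y ∈ K, σ y ≠ y) → x * σ x * σ (σ x) = 1

theorem HasTrivialNorm.mul {K : IntermediateField F L} {x y : L} (hx : HasTrivialNorm K x)
    (hy : HasTrivialNorm K y) : HasTrivialNorm K (x * y) where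
  mem := mul_mem hx.mem hy.mem
  ne_zero := mul_ne_zero hx.ne_zero hy.ne_zero
  mul_mul_eq_one σ hσ := by
    simp only [map_mul]
    linear_combination y * σ y * σ (σ y) * hx.mul_mul_eq_one σ hσ + hy.mul_mul_eq_one σ hσ

variable [FiniteDimensional F L] [IsGalois F L]

theorem mem_iff_forall_fixed (K : IntermediateField F L) (x : L) :
    x ∈ K ↔ ∀ τ : L ≃ₐ[F] L, (∀ y ∈ K, τ y = y) → τ x = x := by
  refine ⟨fun hx τ hτ ↦ hτ x hx, fun h ↦ ?_⟩
  rw [← IsGalois.fixedField_fixingSubgroup K, IntermediateField.mem_fixedField_iff]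
  exact fun τ hτ ↦ h τ fun y hy ↦ hτ ⟨y, hy⟩

theorem map_mem_of_comm (comm : ∀ (σ τ : L ≃ₐ[F] L) (x : L), σ (τ x) = τ (σ x))
    {K : IntermediateField F L} {x : L} (hx : x ∈ K) (σ : L ≃ₐ[F] L) : σ x ∈ K := by
  rw [mem_iff_forall_fixed]
  intro τ hτ
  rw [comm, hτ x hx]

theorem HasTrivialNorm.map (comm : ∀ (σ τ : L ≃ₐ[F] L) (x : L), σ (τ x) = τ (σ x))
    {K : IntermediateField F L} {x : L} (hx : HasTrivialNorm K x) (τ : L ≃ₐ[F] L) : HasTrivialNorm K (τ x) where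
  mem := map_mem_of_comm comm hx.mem τ
  ne_zero := by simpa using hx.ne_zero
  mul_mul_eq_one σ hσ := by
    rw [comm σ τ, comm σ τ, ← map_mul, ← map_mul, hx.mul_mul_eq_one σ hσ, map_one]

theorem exists_fixing_moving {K K' : IntermediateField F L}
    (hK : Module.finrank F K = Module.finrank F K') (hne : K ≠ K') :
    ∃ σ : L ≃ₐ[F] L, (∃ y ∈ K, σ y ≠ y) ∧ ∀ y ∈ K', σ y = y := by
  by_contra! hcon
  apply hne
  apply IntermediateField.eq_of_le_of_finrank_eq _ hK
  intro x hx
  rw [mem_iff_forall_fixed]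
  intro τ hτ
  by_contra h
  obtain ⟨y, hy, h'⟩ := hcon τ ⟨x, hx, h⟩
  exact h' (hτ y hy)

/-- Descent: an element of trivial norm that is a square in an abelian extension is a square. -/
theorem HasTrivialNorm.exists_sq_of_eq_sq
    (comm : ∀ (σ τ : L ≃ₐ[F] L) (x : L), σ (τ x) = τ (σ x)) {K : IntermediateField F L}
    (hK : ∃ (σ : L ≃ₐ[F] L), ∃ y ∈ K, σ y ≠ y) {w t : L} (hw : HasTrivialNorm K w)
    (ht : w = t ^ 2) : ∃ s ∈ K, w = s ^ 2 := by
  refine ⟨t, ?_, ht⟩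
  obtain ⟨σ, hσ⟩ := hK
  have ht0 : t ≠ 0 := by
    rintro rfl
    exact hw.ne_zero (by simpa using ht)
  have hsign {τ : L ≃ₐ[F] L} (hτ : ∀ y ∈ K, τ y = y) : τ t = t ∨ τ t = -t := by
    apply sq_eq_sq_iff_eq_or_eq_neg.mp
    rw [← map_pow, ← ht, hτ w hw.mem]
  -- An automorphism over K only changes the sign of t, and by commutativity it changes σ t by the
  -- same sign.
  have hc : σ t / t ∈ K := by
    rw [mem_iff_forall_fixed]
    intro τ hτ
    rw [map_div₀, comm]
    rcases hsign hτ with h | h <;> simp [h]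
  obtain ⟨c, hct⟩ : ∃ c, σ t / t = c := ⟨_, rfl⟩
  rw [hct] at hc
  have hst : σ t = c * t := by rw [← hct, div_mul_cancel₀ _ ht0]
  have hσt : σ t ≠ 0 := by simpa using ht0
  have hc0 : c ≠ 0 := by rw [← hct]; exact div_ne_zero hσt ht0
  have hσc : σ c ∈ K := map_mem_of_comm comm hc σ
  have hσc0 : σ c ≠ 0 := by simpa using hc0
  have hn := hw.mul_mul_eq_one σ hσ
  have hsq : (t * σ t * σ (σ t)) ^ 2 = 1 := by
    rw [← hn, ht, map_pow, map_pow]; ring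
  have hunit : t * σ t * σ (σ t) ∈ K := by
    rcases eq_or_eq_neg_of_sq_eq_sq _ 1 (hsq.trans (one_pow 2).symm) with h | h <;> rw [h]
    · exact one_mem _
    · exact neg_mem (one_mem _)
  -- The numerator equals t³c²σ(c) = t·w·c²σ(c), and it is ±1.
  have : t = (t * σ t * σ (σ t)) / (w * (c ^ 2 * σ c)) := by
    rw [hst, map_mul, hst, ht]
    field_simp
  rw [this]
  exact div_mem hunit (mul_mem hw.mem (mul_mem (pow_mem hc 2) hσc))

/-- Multiplying the relation by its images under σ and σ² removes the factor from `K i`, turns w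
into w³, and keeps every other factor in its field with trivial norm. The data change at each step,
so the induction quantifies over them; w is a square once w³ is. -/
theorem exists_sq_of_mul_prod_eq_sq {ι : Type*} [DecidableEq ι]
    (comm : ∀ (σ τ : L ≃ₐ[F] L) (x : L), σ (τ x) = τ (σ x)) {K : ι → IntermediateField F L}
    (hK : ∀ i j, Module.finrank F (K i) = Module.finrank F (K j)) (hinj : Function.Injective K)
    {j : ι} (S : Finset ι) (hj : j ∉ S) :
    ∀ (w : L) (u : ι → L) (s : L), HasTrivialNorm (K j) w → (∀ i, HasTrivialNorm (K i) (u i)) →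
      w * ∏ i ∈ S, u i = s ^ 2 → ∃ t : L, w = t ^ 2 := by
  induction S using Finset.induction_on with
  | empty => exact fun w u s _ _ h ↦ ⟨s, by simpa using h⟩
  | insert i S hi ih =>
    intro w u s hw hu h
    obtain ⟨hji, hj⟩ : j ≠ i ∧ j ∉ S := by simpa using hj
    obtain ⟨σ, hσ, hσj⟩ := exists_fixing_moving (hK i j) (hinj.ne hji.symm)
    have hσw : σ w = w := hσj w hw.mem
    obtain ⟨t, ht⟩ := ih hj (w * w * w) (fun l ↦ u l * σ (u l) * σ (σ (u l)))
      (s * σ s * σ (σ s)) ((hw.mul hw).mul hw)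
      (fun l ↦ ((hu l).mul ((hu l).map comm σ)).mul (((hu l).map comm σ).map comm σ)) (by
        have h1 := congrArg σ h
        have h2 := congrArg σ h1
        rw [Finset.prod_insert hi] at h h1 h2
        simp only [map_mul, map_pow, map_prod, hσw] at h1 h2
        rw [Finset.prod_mul_distrib, Finset.prod_mul_distrib, mul_pow, mul_pow, ← h, ← h1, ← h2]
        linear_combination -(w ^ 3 * (∏ l ∈ S, u l) * (∏ l ∈ S, σ (u l)) *
          (∏ l ∈ S, σ (σ (u l)))) * (hu i).mul_mul_eq_one σ hσ)
    refine ⟨t / w, ?_⟩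
    have := hw.ne_zero
    rw [div_pow, ← ht]
    field_simp

end Squares

/-! ### Units modulo squares and the signature rank -/

section Rank

variable (F : Type*) [Field F]

/-- The subgroup of squares of units, written additively. -/
def unitSquares : AddSubgroup (Additive (𝓞 F)ˣ) := (nsmulAddMonoidHom 2).range

/-- The group of units modulo squares, written additively. -/
abbrev UnitsModSquares : Type _ := Additive (𝓞 F)ˣ ⧸ unitSquares F

noncomputable instance : Module (ZMod 2) (UnitsModSquares F) :=
  QuotientAddGroup.zmodModule fun x ↦ ⟨x, rfl⟩

/-- The class of a unit modulo squares. -/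
def unitClass : Additive (𝓞 F)ˣ →+ UnitsModSquares F := QuotientAddGroup.mk' (unitSquares F)

theorem unitClass_eq_zero_iff (u : (𝓞 F)ˣ) :
    unitClass F (Additive.ofMul u) = 0 ↔ ∃ x : (𝓞 F)ˣ, u = x ^ 2 := by
  rw [unitClass, QuotientAddGroup.mk'_apply, QuotientAddGroup.eq_zero_iff]
  constructor
  · rintro ⟨x, hx⟩
    exact ⟨x.toMul, congrArg Additive.toMul hx.symm⟩
  · rintro ⟨x, rfl⟩
    exact ⟨Additive.ofMul x, rfl⟩

/-- The signature map on units modulo squares. -/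
noncomputable def unitClassSignature :
    UnitsModSquares F →ₗ[ZMod 2] ((F →+* ℝ) → ZMod 2) :=
  AddMonoidHom.toZModLinearMap 2 <| QuotientAddGroup.lift (unitSquares F) (unitSignature F) <| by
    rintro _ ⟨x, rfl⟩
    funext v
    have h2 : (2 : ZMod 2) = 0 := by decide
    simp [h2]

theorem unitClassSignature_unitClass (u : Additive (𝓞 F)ˣ) :
    unitClassSignature F (unitClass F u) = unitSignature F u := rfl

theorem range_unitClassSignature :
    LinearMap.range (unitClassSignature F) = unitSignatureGroup F := by
  ext x
  constructor
  · rintro ⟨y, rfl⟩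
    obtain ⟨u, rfl⟩ := QuotientAddGroup.mk'_surjective _ y
    exact ⟨u, rfl⟩
  · rintro ⟨u, rfl⟩
    exact ⟨unitClass F u, rfl⟩

variable [NumberField F]

theorem rank_add_one_le_finrank : Units.rank F + 1 ≤ Module.finrank ℚ F := by
  have h1 := InfinitePlace.card_add_two_mul_card_eq_rank F
  have h2 := InfinitePlace.card_eq_nrRealPlaces_add_nrComplexPlaces F
  have h3 : 0 < Fintype.card (InfinitePlace F) := Fintype.card_pos
  rw [Units.rank]
  omega

theorem exists_spanning_unitClasses :
    ∃ v : Option (Fin (Units.rank F)) → UnitsModSquares F,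
      Submodule.span (ZMod 2) (Set.range v) = ⊤ := by
  obtain ⟨g, hg⟩ := IsCyclic.exists_generator (α := Units.torsion F)
  -- `none` carries a generator of the torsion, which accounts for the extra 1 over the unit rank.
  let v : Option (Fin (Units.rank F)) → UnitsModSquares F := fun o ↦
    o.elim (unitClass F (Additive.ofMul (g : (𝓞 F)ˣ)))
      fun i ↦ unitClass F (Additive.ofMul (Units.fundSystem F i))
  refine ⟨v, ?_⟩
  rw [Submodule.eq_top_iff']
  intro x
  obtain ⟨u, rfl⟩ := QuotientAddGroup.mk'_surjective _ x
  obtain ⟨⟨ζ, e⟩, h, -⟩ := Units.exist_unique_eq_mul_prod F u.toMul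
  obtain ⟨n, rfl⟩ := hg ζ
  have hu : u = n • Additive.ofMul (g : (𝓞 F)ˣ) +
      ∑ i, e i • Additive.ofMul (Units.fundSystem F i) := by
    apply Additive.toMul.injective
    simpa using h
  have hx : unitClass F u = n • v none + ∑ i, e i • v (some i) := by
    rw [hu, map_add, map_sum]
    simp only [map_zsmul]
    rfl
  change unitClass F u ∈ _
  rw [hx]
  refine add_mem (zsmul_mem (Submodule.subset_span (Set.mem_range_self _)) _) (sum_mem fun i _ ↦ ?_)
  exact zsmul_mem (Submodule.subset_span (Set.mem_range_self _)) _

instance : Module.Finite (ZMod 2) (UnitsModSquares F) := by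
  obtain ⟨v, hv⟩ := exists_spanning_unitClasses F
  exact ⟨⟨(Set.finite_range v).toFinset, by simpa using hv⟩⟩

theorem finrank_unitsModSquares_le :
    Module.finrank (ZMod 2) (UnitsModSquares F) ≤ Module.finrank ℚ F := by
  obtain ⟨v, hv⟩ := exists_spanning_unitClasses F
  have h := finrank_range_le_card (R := ZMod 2) v
  rw [Set.finrank, hv, finrank_top, Fintype.card_option, Fintype.card_fin] at h
  exact h.trans (rank_add_one_le_finrank F)

/-- Totally positive units that are independent modulo squares bound the unit signature rank. -/
theorem unitSignatureRank_add_card_le {ι : Type*} [Fintype ι] (w : ι → (𝓞 F)ˣ)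
    (hpos : ∀ i, IsTotallyPositive ((w i : 𝓞 F) : F))
    (hind : ∀ S : Finset ι, (∃ x : (𝓞 F)ˣ, ∏ i ∈ S, w i = x ^ 2) → S = ∅) :
    unitSignatureRank F + Fintype.card ι ≤ Module.finrank ℚ F := by
  classical
  have hker (i : ι) : unitClass F (Additive.ofMul (w i)) ∈
      LinearMap.ker (unitClassSignature F) := by
    rw [LinearMap.mem_ker, unitClassSignature_unitClass]
    funext v
    exact if_neg (hpos i v).le.not_gt
  have hli : LinearIndependent (ZMod 2)
      fun i ↦ (⟨_, hker i⟩ : LinearMap.ker (unitClassSignature F)) := by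
    rw [Fintype.linearIndependent_iff]
    intro g hg
    replace hg := congrArg Subtype.val hg
    simp only [Submodule.coe_sum, Submodule.coe_smul, Submodule.coe_zero] at hg
    have hzero : ∀ c : ZMod 2, c = 0 ∨ c = 1 := by decide
    -- Coefficients are 0 or 1, so a linear relation says that a subproduct is a square.
    have hS : Finset.univ.filter (fun i ↦ g i = 1) = ∅ := by
      apply hind
      rw [← unitClass_eq_zero_iff, ofMul_prod, map_sum, ← hg, Finset.sum_filter]
      refine Finset.sum_congr rfl fun i _ ↦ ?_
      rcases hzero (g i) with h | h <;> simp [h]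
    intro i
    refine (hzero (g i)).resolve_right fun h ↦ ?_
    have : i ∈ Finset.univ.filter (fun i ↦ g i = 1) := by simp [h]
    simp [hS] at this
  have h1 := hli.fintype_card_le_finrank
  have h2 := (unitClassSignature F).finrank_range_add_finrank_ker
  rw [range_unitClassSignature] at h2
  have h3 := finrank_unitsModSquares_le F
  rw [unitSignatureRank]
  omega

end Rank

/-! ### Totally positive units of cubic fields -/

section Cubic

variable {K : Type*} [Field K] [NumberField K]

/-- A fundamental unit has exponent 1 on itself, while a square has even exponents; uniqueness of
exponents rules out equality. -/
theorem exists_totallyPositive_nonsquare (h : Module.finrank ℚ K = 3)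
    (hK : HasTotallyPositiveFundamentalUnits K) :
    ∃ u : (𝓞 K)ˣ, IsTotallyPositive ((u : 𝓞 K) : K) ∧ ¬ ∃ x : (𝓞 K)ˣ, u = x ^ 2 := by
  have hrank : 0 < Units.rank K := by
    have h1 := InfinitePlace.card_add_two_mul_card_eq_rank K
    have h2 := InfinitePlace.card_eq_nrRealPlaces_add_nrComplexPlaces K
    rw [Units.rank]
    omega
  obtain ⟨η, hη, hpos⟩ := hK
  refine ⟨η ⟨0, hrank⟩, hpos _, ?_⟩
  rintro ⟨x, hx⟩
  obtain ⟨⟨ζ, e⟩, hxe, -⟩ := hη x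
  have h1 : η ⟨0, hrank⟩ = ((1 : Units.torsion K) : (𝓞 K)ˣ) *
      ∏ i, η i ^ (Pi.single ⟨0, hrank⟩ 1 : Fin (Units.rank K) → ℤ) i := by
    rw [Finset.prod_eq_single ⟨0, hrank⟩]
    · simp
    · intro i _ hi; simp [Pi.single_eq_of_ne hi]
    · simp
  have h2 : η ⟨0, hrank⟩ = ((ζ ^ 2 : Units.torsion K) : (𝓞 K)ˣ) *
      ∏ i, η i ^ (fun i ↦ e i * 2 : Fin (Units.rank K) → ℤ) i := by
    rw [hx, hxe, mul_pow, ← Finset.prod_pow]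
    simp only [zpow_mul]
    norm_cast
  have := (hη (η ⟨0, hrank⟩)).unique (y₁ := (1, Pi.single ⟨0, hrank⟩ 1))
    (y₂ := (ζ ^ 2, fun i ↦ e i * 2)) h1 h2
  have := congrFun (congrArg Prod.snd this) ⟨0, hrank⟩
  simp only [Pi.single_eq_same] at this
  omega

variable [IsGalois ℚ K]

theorem isTotallyReal_of_odd_finrank (h : Odd (Module.finrank ℚ K)) : IsTotallyReal K where
  isReal w := by
    have := IsUnramifiedAtInfinitePlaces_of_odd_finrank (k := ℚ) (K := K) h
    rcases InfinitePlace.isUnramified_iff.mp (this.isUnramified w) with hw | hw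
    · exact hw
    · exact absurd (IsTotallyReal.isReal (w.comap (algebraMap ℚ K)))
        (InfinitePlace.not_isReal_iff_isComplex.mpr hw)

/-- The product is a σ-invariant unit, hence a rational q with |q|³ = 1. It is positive under a real
embedding v, because v∘σ and v∘σ² are real embeddings as well. -/
theorem mul_mul_eq_one_of_totallyPositive (h : Module.finrank ℚ K = 3) (u : (𝓞 K)ˣ)
    (hu : IsTotallyPositive ((u : 𝓞 K) : K)) {σ : K ≃ₐ[ℚ] K} (hσ : σ ≠ 1) :
    ((u : 𝓞 K) : K) * σ (u : 𝓞 K) * σ (σ (u : 𝓞 K)) = 1 := by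
  let s : 𝓞 K →* 𝓞 K := (RingOfIntegers.mapRingHom (σ : K →+* K) : 𝓞 K →+* 𝓞 K)
  set x : (𝓞 K)ˣ := u * Units.map s u * Units.map s (Units.map s u) with hx
  have hxu : ((x : 𝓞 K) : K) = ((u : 𝓞 K) : K) * σ (u : 𝓞 K) * σ (σ (u : 𝓞 K)) := rfl
  obtain ⟨q, hq⟩ := exists_rat_eq_of_fixed h hσ (x := ((x : 𝓞 K) : K)) (by
    rw [hxu, map_mul, map_mul, apply_apply_apply_eq h hσ]; ring)
  have hnorm : |Algebra.norm ℚ ((x : 𝓞 K) : K)| = 1 := Units.norm K x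
  rw [← hq, ← eq_ratCast (algebraMap ℚ K), Algebra.norm_algebraMap, h, abs_pow,
    pow_eq_one_iff_of_nonneg (abs_nonneg _) (by norm_num)] at hnorm
  have hreal : 0 < InfinitePlace.nrRealPlaces K :=
    InfinitePlace.nrRealPlaces_pos_of_odd_finrank (by rw [h]; decide)
  classical
  obtain ⟨w, hw⟩ := Fintype.card_pos_iff.mp hreal
  have hv (v : K →+* ℝ) : 0 < v ((x : 𝓞 K) : K) := by
    rw [hxu, map_mul, map_mul]
    exact mul_pos (mul_pos (hu v) (hu (v.comp (σ : K →+* K))))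
      (hu (v.comp ((σ : K →+* K).comp (σ : K →+* K))))
  have hqpos := hv (InfinitePlace.embedding_of_isReal hw)
  rw [← hq, map_ratCast] at hqpos
  rw [abs_of_pos (by exact_mod_cast hqpos)] at hnorm
  rw [← hxu, ← hq, hnorm, Rat.cast_one]

variable {L : Type*} [Field L] [NumberField L]

theorem hasTrivialNorm_of_totallyPositive (h : Module.finrank ℚ K = 3) (u : (𝓞 K)ˣ)
    (hu : IsTotallyPositive ((u : 𝓞 K) : K)) (ψ : K →ₐ[ℚ] L) :
    HasTrivialNorm ψ.fieldRange (ψ (u : 𝓞 K)) where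
  mem := ⟨_, rfl⟩
  ne_zero := by simp
  mul_mul_eq_one σ hσ := by
    algebraize [(ψ : K →+* L)]
    have hcomm (x : K) : ψ (σ.restrictNormal K x) = σ (ψ x) := σ.restrictNormal_commutes K x
    have hne : σ.restrictNormal K ≠ 1 := by
      intro h1
      obtain ⟨_, ⟨y, rfl⟩, hy⟩ := hσ
      apply hy
      have := hcomm y
      rw [h1] at this
      exact this.symm
    rw [← hcomm, ← hcomm, ← map_mul, ← map_mul, mul_mul_eq_one_of_totallyPositive h u hu hne,
      map_one]

omit [IsGalois ℚ K] in
theorem not_exists_sq_in_fieldRange (u : (𝓞 K)ˣ) (hu : ¬ ∃ x : (𝓞 K)ˣ, u = x ^ 2)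
    (ψ : K →ₐ[ℚ] L) : ¬ ∃ s ∈ ψ.fieldRange, ψ (u : 𝓞 K) = s ^ 2 := by
  rintro ⟨_, ⟨y, rfl⟩, hy⟩
  have hy' : ((u : 𝓞 K) : K) = y ^ 2 := ψ.injective (by rw [map_pow]; exact hy)
  have hint : IsIntegral ℤ y := by
    apply IsIntegral.of_pow (n := 2) (by norm_num)
    rw [← hy']
    exact RingOfIntegers.isIntegral_coe _
  obtain ⟨z, rfl⟩ : ∃ z : 𝓞 K, (z : K) = y := ⟨⟨y, hint⟩, rfl⟩
  have hsq : (u : 𝓞 K) = z ^ 2 := RingOfIntegers.ext hy'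
  have hunit : IsUnit z := by
    rw [← isUnit_pow_iff (n := 2) (by norm_num), ← hsq]
    exact u.isUnit
  exact hu ⟨hunit.unit, Units.ext hsq⟩

/-- A homomorphism from a totally real field corestricts to the maximal real subfield. -/
noncomputable def toMaximalRealSubfield [IsTotallyReal K] (ψ : K →+* L) :
    K →+* maximalRealSubfield L :=
  ψ.codRestrict (maximalRealSubfield L) fun x φ ↦
    RingHom.congr_fun (IsTotallyReal.complexEmbedding_isReal (φ.comp ψ)) x

end Cubic

/-! ### Transfer to cyclotomic fields and conclusion -/

/-- Allowing every multiple n of m lets finitely many cubic fields share one L. The unit stays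
totally positive because real embeddings of L⁺ restrict to real embeddings of k. -/
theorem exists_level_of_mem_totallyPositiveCyclicCubicFields {k : IntermediateField ℚ ℂ}
    (hk : k ∈ totallyPositiveCyclicCubicFields) :
    ∃ m : ℕ, 0 < m ∧ ∀ (n : ℕ) [NeZero n], m ∣ n → ∀ (L : Type) [Field L] [NumberField L]
      [IsCyclotomicExtension {n} ℚ L] (φ : L →ₐ[ℚ] ℂ),
      ∃ (K : IntermediateField ℚ L) (w : (𝓞 (maximalRealSubfield L))ˣ),
        K.map φ = k ∧ Module.finrank ℚ K = 3 ∧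
        IsTotallyPositive ((w : 𝓞 (maximalRealSubfield L)) : maximalRealSubfield L) ∧
        HasTrivialNorm K (((w : 𝓞 (maximalRealSubfield L)) : maximalRealSubfield L) : L) ∧
        ¬ ∃ s ∈ K, (((w : 𝓞 (maximalRealSubfield L)) : maximalRealSubfield L) : L) = s ^ 2 := by
  obtain ⟨_, ⟨h3, hgal, -⟩, hfund⟩ := hk
  obtain ⟨u, hu, husq⟩ := exists_totallyPositive_nonsquare h3 hfund
  have : IsTotallyReal k := isTotallyReal_of_odd_finrank (by rw [h3]; decide)
  obtain ⟨m, hm, hkm⟩ := exists_level (le_cyclotomicClosure k h3)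
  refine ⟨m, hm, fun n _ hmn L _ _ _ φ ↦ ?_⟩
  have hkφ := hkm.trans (adjoin_roots_le_fieldRange hmn φ)
  have hφ : Function.Injective φ := φ.injective
  choose f hf using fun x : k ↦ AlgHom.mem_fieldRange.mp (hkφ x.2)
  let ψ : k →ₐ[ℚ] L := RingHom.toRatAlgHom
    { toFun := f
      map_one' := hφ (by rw [hf, map_one]; rfl)
      map_mul' x y := hφ (by rw [hf, map_mul, hf, hf]; rfl)
      map_zero' := hφ (by rw [hf, map_zero]; rfl)
      map_add' x y := hφ (by rw [hf, map_add, hf, hf]; rfl) }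
  have hψ (x : k) : φ (ψ x) = x := hf x
  refine ⟨ψ.fieldRange, Units.map (RingOfIntegers.mapRingHom
    (toMaximalRealSubfield (ψ : k →+* L)) : 𝓞 k →* 𝓞 (maximalRealSubfield L)) u,
    ?_, ?_, fun v ↦ hu (v.comp (toMaximalRealSubfield (ψ : k →+* L))),
    hasTrivialNorm_of_totallyPositive h3 u hu ψ, not_exists_sq_in_fieldRange u husq ψ⟩
  · ext z
    constructor
    · rintro ⟨_, ⟨x, rfl⟩, rfl⟩
      exact (hψ x).symm ▸ x.2
    · intro hz
      exact ⟨_, ⟨⟨z, hz⟩, rfl⟩, hψ _⟩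
  · rw [← h3]
    exact (AlgEquiv.ofInjectiveField ψ).toLinearEquiv.finrank_eq.symm

theorem two_mul_finrank_maximalRealSubfield {n : ℕ} (hn : 2 < n) (L : Type*) [Field L]
    [NumberField L] [IsCyclotomicExtension {n} ℚ L] :
    2 * Module.finrank ℚ (maximalRealSubfield L) = n.totient := by
  have : NeZero n := ⟨by omega⟩
  have := IsCyclotomicExtension.Rat.isCMField L (S := {n}) ⟨n, rfl, hn⟩
  rw [← IsCyclotomicExtension.Rat.finrank n L,
    ← Module.finrank_mul_finrank ℚ (maximalRealSubfield L) L,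
    Algebra.IsQuadraticExtension.finrank_eq_two (maximalRealSubfield L) L, mul_comm]

theorem exists_moving {F L : Type*} [Field F] [Field L] [Algebra F L] [FiniteDimensional F L]
    [IsGalois F L] {K : IntermediateField F L} (h : Module.finrank F K = 3) :
    ∃ σ : L ≃ₐ[F] L, ∃ y ∈ K, σ y ≠ y := by
  by_contra! hcon
  have : K = ⊥ := by
    rw [eq_bot_iff]
    intro x hx
    rw [IsGalois.mem_bot_iff_fixed]
    exact fun σ ↦ hcon σ x hx
  rw [this, IntermediateField.finrank_bot] at h
  omega

theorem unitSignatureRank_add_le_of_cyclotomic {N n : ℕ} [NeZero n]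
    {k : Fin N → IntermediateField ℚ ℂ} (hinj : Function.Injective k) (L : Type) [Field L]
    [NumberField L] [IsCyclotomicExtension {n} ℚ L] (φ : L →ₐ[ℚ] ℂ)
    (hdata : ∀ i, ∃ (K : IntermediateField ℚ L) (w : (𝓞 (maximalRealSubfield L))ˣ),
        K.map φ = k i ∧ Module.finrank ℚ K = 3 ∧
        IsTotallyPositive ((w : 𝓞 (maximalRealSubfield L)) : maximalRealSubfield L) ∧
        HasTrivialNorm K (((w : 𝓞 (maximalRealSubfield L)) : maximalRealSubfield L) : L) ∧
        ¬ ∃ s ∈ K, (((w : 𝓞 (maximalRealSubfield L)) : maximalRealSubfield L) : L) = s ^ 2) :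
    unitSignatureRank (maximalRealSubfield L) + N ≤ Module.finrank ℚ (maximalRealSubfield L) := by
  choose K w hmap h3 hpos hnorm hsq using hdata
  have hgal : IsAbelianGalois ℚ L := IsCyclotomicExtension.isAbelianGalois {n} ℚ L
  have comm (σ τ : L ≃ₐ[ℚ] L) (x : L) : σ (τ x) = τ (σ x) :=
    DFunLike.congr_fun (hgal.toIsMulCommutative.is_comm.comm σ τ) x
  have hK : Function.Injective K := fun i j h ↦ hinj (by rw [← hmap i, ← hmap j, h])
  have := unitSignatureRank_add_card_le (maximalRealSubfield L) w hpos fun S ⟨x, hx⟩ ↦ by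
    by_contra hS
    obtain ⟨j, hj⟩ := Finset.nonempty_iff_ne_empty.mpr hS
    have hx' := congrArg (fun u : (𝓞 (maximalRealSubfield L))ˣ ↦
      (((u : 𝓞 (maximalRealSubfield L)) : maximalRealSubfield L) : L)) hx
    rw [← Finset.mul_prod_erase S w hj] at hx'
    obtain ⟨t, ht⟩ := exists_sq_of_mul_prod_eq_sq comm (fun i i' ↦ by rw [h3, h3]) hK (S.erase j)
      (Finset.notMem_erase j S) _ _ (((x : 𝓞 (maximalRealSubfield L)) : maximalRealSubfield L) : L)
      (hnorm j) hnorm (by simpa using hx')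
    exact hsq j ((hnorm j).exists_sq_of_eq_sq comm (exists_moving (h3 j)) ht)
  simpa using this

end SignatureRank

theorem theorem3
    (h : SignatureRank.totallyPositiveCyclicCubicFields.Infinite) :
    ∀ N : ℕ, ∃ m : ℕ, 2 < m ∧ (Odd m ∨ 4 ∣ m) ∧
      (N : ℝ) ≤ (Nat.totient m : ℝ) / 2 -
        (SignatureRank.unitSignatureRank
          (NumberField.maximalRealSubfield (CyclotomicField m ℚ)) : ℝ) := by
  intro N
  let k : Fin N → IntermediateField ℚ ℂ := fun i ↦ h.natEmbedding _ i
  have hinj : Function.Injective k := fun i j hij ↦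
    Fin.ext ((h.natEmbedding _).injective (Subtype.ext hij))
  choose m hm hdata using fun i : Fin N ↦
    SignatureRank.exists_level_of_mem_totallyPositiveCyclicCubicFields (h.natEmbedding _ i).2
  -- The factor 4 ensures both 4 ∣ n and n > 2, even for an empty product.
  obtain ⟨n, hn⟩ : ∃ n, n = 4 * ∏ i, m i := ⟨_, rfl⟩
  have hprod : 0 < ∏ i, m i := Finset.prod_pos fun i _ ↦ hm i
  have hn2 : 2 < n := by omega
  have : NeZero n := ⟨by omega⟩
  refine ⟨n, hn2, Or.inr ⟨_, hn⟩, ?_⟩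
  have hcyc : IsCyclotomicExtension {n} ℚ (CyclotomicField n ℚ) := by
    convert CyclotomicField.isCyclotomicExtension n ℚ
    · rfl
    · exact Subsingleton.elim _ _
  have hle := SignatureRank.unitSignatureRank_add_le_of_cyclotomic (n := n) hinj (CyclotomicField n ℚ)
    IsAlgClosed.lift fun i ↦ hdata i n
      (((Finset.dvd_prod_of_mem m (Finset.mem_univ i)).mul_left 4).trans hn.symm.dvd) _ _
  have hdeg := SignatureRank.two_mul_finrank_maximalRealSubfield hn2 (CyclotomicField n ℚ)
  have hle' : (SignatureRank.unitSignatureRank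
      (NumberField.maximalRealSubfield (CyclotomicField n ℚ)) : ℝ) + N ≤
      (Module.finrank ℚ (NumberField.maximalRealSubfield (CyclotomicField n ℚ)) : ℝ) := by
    exact_mod_cast hle
  rw [← hdeg]
  push_cast
  linarith
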